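/- Setting. Let $(V,\omega_0)$ be a real symplectic vector space of dimension $2n\ge 2$ with a compatible positive complex structure $J_0$ and scalar product $g_0(u,v)=\omega_0(J_0u,v)$, let $L\subseteq V$ be Lagrangian, and let $\check H=L^2(L)$. Let $\lambda:\widetilde G\to Sp(V,\omega_0)$ be the metaplectic group (the connected Lie group double cover) and $\check\sigma$ a Segal--Shale--Weil representation of $\widetilde G$ on $\check H$, i.e. a continuous unitary representation with $\check\sigma(g)W(v)\check\sigma(g)^{-1}=W(\lambda(g)v)$ for the operators $W(v)$, $v\in V$, of a Schrödinger representation (with parameter $\hbar\neq0$) on $L^2(L)$. Let $H$ be the continuous dual of $\check H$, $\sigma(g)f=f\circ\check\sigma(g)^{-1}$ the dual representation on $H$, $CH$ the algebra of compact operators on $\check H$ with the operator norm, and $\rho(g)a=\check\sigma(g)\circ a\circ\check\sigma(g)^{-1}$. Let $(M,\omega)$ be a symplectic manifold of dimension $2n$ with a metaplectic structure: a smooth principal $\widetilde G$-bundle $\pi_P:\mathcal P\to M$ and a smooth map $\Lambda$ over $M$ from $\mathcal P$ to the bundle of symplectic frames of $M$ with $\Lambda(pg)=\Lambda(p)\circ\lambda(g)$.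 Let $\mathcal H=\mathcal P\times_\sigma H$ be the oscillator bundle and $\mathcal{CH}=\mathcal P\times_\rho CH$ (both with the quotient topology), and let $J:\mathcal H\to M\times H$ be a Kuiper map, i.e. a fibre preserving homeomorphism that is linear and unitary on each fibre. Give $\mathcal H$ the smooth structure for which $J$ is a diffeomorphism, and let $\Gamma(\mathcal H)$ be the space of smooth sections. Let $J_{CH}:\mathcal{CH}\to M\times CH$ be the fibrewise linear and continuous bijection with $J_{CH}[(r,v\otimes f)]=(\pi_P(r),\,v'\otimes f')$, where $f'=\mathrm{pr}_2J[(r,f)]$ and $v'=(\mathrm{pr}_2J[(r,v^\flat)])^\sharp$, with $v^\flat=(v,\cdot)_{\check H}\in H$, with $\sharp:H\to\check H$ the inverse of $\flat$, and with $v\otimes f$ the operator $w\mapsto f(w)v$. The algebra $CH$ acts from the right on $\mathcal H$ by $h\cdot a=h\cdot_{\mathcal H}J_{CH}^{-1}(m,a)$ for $h$ in the fibre over $m$, where $[(r,f)]\cdot_{\mathcal H}[(r,b)]=[(r,f\circ b)]$, and it acts on sections pointwise. Let $\Phi=TJ^{-1}\circ\Phi^H\circ TJ$ be the Kuiper connection,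 where $\Phi^H(t,v)=(0,v)$ on $T(M\times H)$; let $\kappa=\mathrm{pr}_2\circ vl^{-1}\circ\Phi$ be its connector, where $vl(x,y)=\frac{d}{dt}\big|_{t=0}(x+ty)$ is the vertical lift; and for a smooth vector field $X$ on $M$ let $\nabla_Xs=\kappa\circ Ts\circ X$. Claim. For every smooth vector field $X$ on $M$, $\nabla_X$ maps $\Gamma(\mathcal H)$ to $\Gamma(\mathcal H)$ and is a linear differential operator of order at most one: in each chart of $M$ and in the bundle chart $J$ it has the form $\sum_i a_i(x)\partial_i+a_0(x)$ with smooth coefficients in the bounded linear operators on $H$. Moreover, for all $s\in\Gamma(\mathcal H)$ and $a\in CH$, the section $s\cdot a$ is again smooth and $$\nabla_X(s\cdot a)=(\nabla_Xs)\cdot a .$$ -/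

import Mathlib

open MeasureTheory
open scoped Manifold ContDiff Topology InnerProductSpace

set_option linter.unusedSectionVars false
set_option linter.unusedVariables false

noncomputable section

namespace Oscillator

/-! ### The dual of a Hilbert space and its compact operators -/

section Hilbert

variable (K : Type*) [NormedAddCommGroup K] [InnerProductSpace ℂ K] [CompleteSpace K]

/-- The continuous dual of a complex Hilbert space `K`, with the dual norm. -/
abbrev HDual : Type _ := StrongDual ℂ K

/-- The algebra of compact operators on `K`, with the operator norm. -/
abbrev CompOp : Type _ := compactOperator (RingHom.id ℂ) K K

variable {K}

/-- The Riesz representative `f♯` of a functional: `f v = ⟪f♯, v⟫`. -/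
def sharp (f : HDual K) : K := (InnerProductSpace.toDual ℂ K).symm f

/-- The functional `v♭ = ⟪v, ·⟫`. -/
def flat (v : K) : HDual K := InnerProductSpace.toDual ℂ K v

/-- The scalar product `(f, g) = (g♯, f♯)` of the dual, antilinear in the left variable. -/
def dualInner (f g : HDual K) : ℂ := inner ℂ (sharp g) (sharp f)

theorem dualInner_self (f : HDual K) : dualInner f f = ((‖f‖ ^ 2 : ℝ) : ℂ) := by
  unfold dualInner sharp
  rw [inner_self_eq_norm_sq_to_K, LinearIsometryEquiv.norm_map]
  push_cast
  rfl

/-- The rank one operator `u ⊗ v : w ↦ v(w) u`. -/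
def rankOneOp (u : K) (v : HDual K) : CompOp K :=
  ⟨v.smulRight u, by
    have h1 : IsCompactOperator (ContinuousLinearMap.toSpanSingleton ℂ u) :=
      isCompactOperator_of_locallyCompactSpace_rng
        (ContinuousLinearMap.toSpanSingleton ℂ u)
    exact h1.comp_clm v⟩

/-- The right action of a compact operator on a functional: `u · a = u ∘ a`. -/
def dualAct (f : HDual K) (a : CompOp K) : HDual K := f ∘L (a : K →L[ℂ] K)

/-- Conjugation `a ↦ U ∘ a ∘ U⁻¹` of compact operators by a unitary operator. -/
def conjFun (U : K ≃ₗᵢ[ℂ] K) (a : CompOp K) : CompOp K :=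
  ⟨(U : K →L[ℂ] K) ∘L (a : K →L[ℂ] K) ∘L (U.symm : K →L[ℂ] K),
    (IsCompactOperator.comp_clm a.2 (U.symm : K →L[ℂ] K)).clm_comp (U : K →L[ℂ] K)⟩

theorem conjFun_apply (U : K ≃ₗᵢ[ℂ] K) (a : CompOp K) (v : K) :
    (conjFun U a : K →L[ℂ] K) v = U ((a : K →L[ℂ] K) (U.symm v)) := rfl

theorem continuous_conjFun (U : K ≃ₗᵢ[ℂ] K) : Continuous (conjFun U) := by
  refine Continuous.subtype_mk ?_ _
  exact continuous_const.clm_comp (continuous_subtype_val.clm_comp continuous_const)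

/-- Conjugation of compact operators by a unitary operator, as a linear homeomorphism. -/
def conjEquiv (U : K ≃ₗᵢ[ℂ] K) : CompOp K ≃L[ℂ] CompOp K where
  toFun := conjFun U
  invFun := conjFun U.symm
  map_add' a b := by ext v; simp [conjFun_apply]
  map_smul' c a := by ext v; simp [conjFun_apply]
  left_inv a := by ext v; simp [conjFun_apply]
  right_inv a := by ext v; simp [conjFun_apply]
  continuous_toFun := continuous_conjFun U
  continuous_invFun := continuous_conjFun U.symm

/-- The dual `f ↦ f ∘ U⁻¹` of a unitary operator, as a linear homeomorphism. -/
def dualEquiv (U : K ≃ₗᵢ[ℂ] K) : HDual K ≃L[ℂ] HDual K where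
  toFun f := f ∘L (U.symm : K →L[ℂ] K)
  invFun f := f ∘L (U : K →L[ℂ] K)
  map_add' f g := by ext v; simp
  map_smul' c f := by ext v; simp
  left_inv f := by ext v; simp
  right_inv f := by ext v; simp
  continuous_toFun := continuous_id.clm_comp continuous_const
  continuous_invFun := continuous_id.clm_comp continuous_const

/-- The dual `σ` of a unitary representation `τ`: `σ(g) f = f ∘ τ(g)⁻¹`. -/
def dualRep {G : Type*} [Group G] (τ : G →* (K ≃ₗᵢ[ℂ] K)) : G →* (HDual K ≃L[ℂ] HDual K) where
  toFun g := dualEquiv (τ g)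
  map_one' := by ext f v; simp [dualEquiv]; rfl
  map_mul' g h := by ext f v; simp [dualEquiv]; rfl

/-- The representation `ρ(g) a = τ(g) ∘ a ∘ τ(g)⁻¹` on compact operators. -/
def conjRep {G : Type*} [Group G] (τ : G →* (K ≃ₗᵢ[ℂ] K)) : G →* (CompOp K ≃L[ℂ] CompOp K) where
  toFun g := conjEquiv (τ g)
  map_one' := by ext a v; rw [map_one]; rfl
  map_mul' g h := by ext a v; rw [map_mul]; rfl

end Hilbert

/-! ### Symplectic vector spaces, the metaplectic group and the Segal-Shale-Weil representation -/

section LinearSymplectic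

/-- A symplectic form `form` and a compatible positive complex structure `cplx` on `V`, whose
associated scalar product is the given one, with a Lagrangian subspace `lagr`. -/
structure SymplecticSpace (V : Type*) [NormedAddCommGroup V] [InnerProductSpace ℝ V] where
  form : LinearMap.BilinForm ℝ V
  cplx : V →ₗ[ℝ] V
  lagr : Submodule ℝ V
  form_self : ∀ u, form u u = 0
  cplx_cplx : ∀ u, cplx (cplx u) = -u
  inner_eq : ∀ u v, inner ℝ u v = form (cplx u) v
  mem_lagr_iff : ∀ u, u ∈ lagr ↔ ∀ w ∈ lagr, form u w = 0

variable {V : Type*} [NormedAddCommGroup V] [InnerProductSpace ℝ V]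

/-- The symplectic group `Sp(V)`, a closed subgroup of the group of invertible endomorphisms. -/
def SymplecticSpace.Sp (S : SymplecticSpace V) : Subgroup (V →L[ℝ] V)ˣ where
  carrier := {g | ∀ u v, S.form ((g : V →L[ℝ] V) u) ((g : V →L[ℝ] V) v) = S.form u v}
  one_mem' := by intro u v; simp
  mul_mem' := by
    intro g h hg hh u v
    have := hg ((h : V →L[ℝ] V) u) ((h : V →L[ℝ] V) v)
    rw [hh] at this
    simpa using this
  inv_mem' := by
    intro g hg u v
    have h := hg ((g⁻¹ : (V →L[ℝ] V)ˣ).1 u) ((g⁻¹ : (V →L[ℝ] V)ˣ).1 v)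
    have e : ∀ w : V, (g : V →L[ℝ] V) ((g⁻¹ : (V →L[ℝ] V)ˣ).1 w) = w := by
      intro w
      exact congrArg (fun A : V →L[ℝ] V => A w) g.mul_inv
    rw [e, e] at h
    exact h.symm

/-- The endomorphism of `V` given by an element of the symplectic group. -/
def SymplecticSpace.toEnd {S : SymplecticSpace V} (g : S.Sp) : V →L[ℝ] V := (g : (V →L[ℝ] V)ˣ)

variable [FiniteDimensional ℝ V] [MeasurableSpace V] [BorelSpace V]

/-- The Hilbert space `L²(L)` of the Lagrangian subspace `L`, for the Lebesgue measure of the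
scalar product. -/
abbrev SymplecticSpace.L2 (S : SymplecticSpace V) : Type _ :=
  Lp ℂ 2 (volume : Measure S.lagr)

/-- The position part `q ∈ L` of `v = q + p`, `p ∈ L^⊥`. -/
def SymplecticSpace.pos (S : SymplecticSpace V) (v : V) : S.lagr :=
  S.lagr.orthogonalProjectionOnto v

/-- The momentum part `p ∈ L^⊥` of `v = q + p`, `q ∈ L`. -/
def SymplecticSpace.mom (S : SymplecticSpace V) (v : V) : V := v - (S.pos v : V)

/-- The phase `exp (i ħ (ω(p, x) - ω(p, q) / 2))`. -/
def SymplecticSpace.phase (S : SymplecticSpace V) (ħ : ℝ) (v : V) (x : S.lagr) : ℂ :=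
  Complex.exp (((ħ * (S.form (S.mom v) x - S.form (S.mom v) (S.pos v) / 2) : ℝ) : ℂ) * Complex.I)

theorem SymplecticSpace.memLp_weyl (S : SymplecticSpace V) (ħ : ℝ) (v : V) (f : S.L2) :
    MemLp (fun x : S.lagr => S.phase ħ v x * f (x - S.pos v)) 2 volume := by
  have h1 : MemLp (fun x : S.lagr => f (x - S.pos v)) 2 volume :=
    (Lp.memLp f).comp_measurePreserving (measurePreserving_sub_right volume (S.pos v))
  have hc : Continuous (S.phase ħ v) := by
    have h2 : Continuous (fun x : S.lagr => S.form (S.mom v) x) :=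
      ((S.form (S.mom v)).continuous_of_finiteDimensional).comp continuous_subtype_val
    unfold SymplecticSpace.phase
    fun_prop
  refine h1.of_le (hc.aestronglyMeasurable.mul h1.1) (Filter.Eventually.of_forall fun x => ?_)
  rw [norm_mul, SymplecticSpace.phase, Complex.norm_exp_ofReal_mul_I, one_mul]

/-- The operators of the Schroedinger representation (with parameter `ħ`) on `L²(L)`:
`(W(v) f)(x) = exp (i ħ (ω(p, x) - ω(p, q) / 2)) f(x - q)` for `v = q + p`. They satisfy
`W(v) W(w) = exp (i ħ ω(v, w) / 2) W(v + w)`. -/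
def SymplecticSpace.weyl (S : SymplecticSpace V) (ħ : ℝ) (v : V) (f : S.L2) : S.L2 :=
  (S.memLp_weyl ħ v f).toLp _

variable {EG : Type*} [NormedAddCommGroup EG] [NormedSpace ℝ EG]

/-- `G` with `cov` is the metaplectic group: a connected Lie group that covers the symplectic
group twice, by a smooth homomorphism. (`Sp` is an embedded submanifold of `End V`.) -/
structure MetaplecticGroup (S : SymplecticSpace V) (EG : Type*) [NormedAddCommGroup EG]
    [NormedSpace ℝ EG] (G : Type*) [Group G] [TopologicalSpace G] [ChartedSpace EG G] where
  cov : G →* S.Sp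
  lieGroup : LieGroup 𝓘(ℝ, EG) ∞ G
  connected : ConnectedSpace G
  smooth_cov : ContMDiff 𝓘(ℝ, EG) 𝓘(ℝ, V →L[ℝ] V) ∞ (fun g : G => S.toEnd (cov g))
  isCoveringMap : IsCoveringMap cov
  two_fold : ∀ A : S.Sp, {g : G | cov g = A}.ncard = 2

variable {G : Type*} [Group G] [TopologicalSpace G] [ChartedSpace EG G]

/-- A Segal-Shale-Weil representation: a continuous unitary representation of the metaplectic
group on `L²(L)` that intertwines the Schroedinger representation with its twists by the
symplectic group. -/
structure SegalShaleWeil {S : SymplecticSpace V} (mp : MetaplecticGroup S EG G) (ħ : ℝ) where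
  rep : G →* (S.L2 ≃ₗᵢ[ℂ] S.L2)
  continuous_rep : Continuous (fun x : G × S.L2 => rep x.1 x.2)
  intertwines : ∀ (g : G) (v : V) (f : S.L2),
    rep g (S.weyl ħ v f) = S.weyl ħ (S.toEnd (mp.cov g) v) (rep g f)

end LinearSymplectic

/-! ### Principal bundles and associated bundles -/

section Principal

variable (E EG EP : Type*) [NormedAddCommGroup E] [NormedSpace ℝ E]
  [NormedAddCommGroup EG] [NormedSpace ℝ EG] [NormedAddCommGroup EP] [NormedSpace ℝ EP]
  (M G P : Type*) [TopologicalSpace M] [ChartedSpace E M]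
  [Group G] [TopologicalSpace G] [ChartedSpace EG G]
  [TopologicalSpace P] [ChartedSpace EP P] [MulAction Gᵐᵒᵖ P]

/-- A smooth principal `G`-bundle `proj : P → M`; the right action `p · g` is
`MulOpposite.op g • p`. -/
structure PrincipalBundle where
  proj : P → M
  isManifold : IsManifold 𝓘(ℝ, EP) ∞ P
  proj_act : ∀ (p : P) (g : G), proj (MulOpposite.op g • p) = proj p
  locally_trivial : ∀ m : M, ∃ U : Set M, IsOpen U ∧ m ∈ U ∧
    ∃ φ : OpenPartialHomeomorph P (M × G),
      φ.source = proj ⁻¹' U ∧ φ.target = U ×ˢ Set.univ ∧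
      ContMDiffOn 𝓘(ℝ, EP) (𝓘(ℝ, E).prod 𝓘(ℝ, EG)) ∞ φ φ.source ∧
      ContMDiffOn (𝓘(ℝ, E).prod 𝓘(ℝ, EG)) 𝓘(ℝ, EP) ∞ φ.symm φ.target ∧
      (∀ p ∈ φ.source, (φ p).1 = proj p) ∧
      ∀ p ∈ φ.source, ∀ g : G, φ (MulOpposite.op g • p) = ((φ p).1, (φ p).2 * g)

variable {E EG EP M G P}

theorem PrincipalBundle.exists_act (B : PrincipalBundle E EG EP M G P) {p q : P}
    (h : B.proj p = B.proj q) : ∃ g : G, q = MulOpposite.op g • p := by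
  obtain ⟨U, -, hm, φ, hs, -, -, -, h1, h2⟩ := B.locally_trivial (B.proj p)
  have hp : p ∈ φ.source := by rw [hs]; exact hm
  have hq : q ∈ φ.source := by rw [hs]; simpa [← h] using hm
  refine ⟨(φ p).2⁻¹ * (φ q).2, ?_⟩
  have hpg : MulOpposite.op ((φ p).2⁻¹ * (φ q).2) • p ∈ φ.source := by
    rw [hs, Set.mem_preimage, B.proj_act]; exact hm
  refine φ.injOn hq hpg ?_
  rw [h2 p hp]
  refine Prod.ext ?_ ?_
  · simp [h1 p hp, h1 q hq, h]
  · simp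

theorem PrincipalBundle.act_free (B : PrincipalBundle E EG EP M G P) {p : P} {g : G}
    (h : MulOpposite.op g • p = p) : g = 1 := by
  obtain ⟨U, -, hm, φ, hs, -, -, -, -, h2⟩ := B.locally_trivial (B.proj p)
  have hp : p ∈ φ.source := by rw [hs]; exact hm
  have := h2 p hp g
  rw [h] at this
  simpa using congrArg Prod.snd this

theorem PrincipalBundle.proj_surjective (B : PrincipalBundle E EG EP M G P) :
    Function.Surjective B.proj := by
  intro m
  obtain ⟨U, -, hm, φ, hs, ht, -, -, h1, -⟩ := B.locally_trivial m
  have hmem : (m, (1 : G)) ∈ φ.target := by rw [ht]; exact ⟨hm, trivial⟩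
  refine ⟨φ.symm (m, 1), ?_⟩
  rw [← h1 _ (φ.map_target hmem), φ.right_inv hmem]

end Principal

section Associated

variable {G X : Type*} [Group G] [NormedAddCommGroup X] [NormedSpace ℂ X]
  (P : Type*) [MulAction Gᵐᵒᵖ P] (κ : G →* (X ≃L[ℂ] X))

/-- The equivalence relation `(r, v) ∼ (r g⁻¹, κ(g) v)` of the associated bundle. -/
def assocSetoid : Setoid (P × X) where
  r a b := ∃ g : G, b.1 = MulOpposite.op g⁻¹ • a.1 ∧ b.2 = κ g a.2
  iseqv :=
    { refl := fun a => ⟨1, by simp, by rw [map_one]; rfl⟩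
      symm := by
        rintro a b ⟨g, h1, h2⟩
        refine ⟨g⁻¹, ?_, ?_⟩
        · rw [h1, smul_smul, ← MulOpposite.op_mul]; simp
        · rw [h2]
          change a.2 = (κ g⁻¹ * κ g) a.2
          rw [← map_mul, inv_mul_cancel, map_one]; rfl
      trans := by
        rintro a b c ⟨g, h1, h2⟩ ⟨h, h3, h4⟩
        refine ⟨h * g, ?_, ?_⟩
        · rw [h3, h1, smul_smul, ← MulOpposite.op_mul]; simp
        · rw [h4, h2, map_mul]; rfl }

/-- The associated bundle `P ×_κ X`. -/
def AssocBundle : Type _ := Quotient (assocSetoid P κ)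

/-- The quotient (final) topology. -/
instance [TopologicalSpace P] : TopologicalSpace (AssocBundle P κ) :=
  inferInstanceAs (TopologicalSpace (Quotient (assocSetoid P κ)))

variable {P}

/-- The class `[(r, v)]`. -/
def AssocBundle.mk (r : P) (v : X) : AssocBundle P κ := Quotient.mk (assocSetoid P κ) (r, v)

variable {κ}

theorem AssocBundle.ind {p : AssocBundle P κ → Prop} (h : ∀ r v, p (AssocBundle.mk κ r v))
    (x : AssocBundle P κ) : p x :=
  Quotient.ind (s := assocSetoid P κ) (fun a => h a.1 a.2) x

theorem AssocBundle.mk_act (r : P) (g : G) (v : X) :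
    AssocBundle.mk κ (MulOpposite.op g⁻¹ • r) (κ g v) = AssocBundle.mk κ r v :=
  (Quotient.sound (s := assocSetoid P κ) ⟨g, rfl, rfl⟩).symm

/-- Some frame `r` with `x = [(r, v)]` for some `v`. -/
def AssocBundle.frameOf (x : AssocBundle P κ) : P := (Quotient.out (s := assocSetoid P κ) x).1

open Classical in
/-- The coordinate of `x` in the frame `r`: the vector `v` with `x = [(r, v)]` (if `x` does not
lie in the fibre over the base point of `r`, the value is `0` and never used). -/
def AssocBundle.coord (r : P) (x : AssocBundle P κ) : X :=
  if h : ∃ v, AssocBundle.mk κ r v = x then h.choose else 0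

/-- The fibrewise operation `x + t y`, i.e. `[(r, v)] + t [(r, w)] = [(r, v + t w)]`. -/
def AssocBundle.addSMul (x y : AssocBundle P κ) (t : ℝ) : AssocBundle P κ :=
  AssocBundle.mk κ x.frameOf
    (AssocBundle.coord x.frameOf x + (t : ℂ) • AssocBundle.coord x.frameOf y)

variable {E EG EP M : Type*} [NormedAddCommGroup E] [NormedSpace ℝ E]
  [NormedAddCommGroup EG] [NormedSpace ℝ EG] [NormedAddCommGroup EP] [NormedSpace ℝ EP]
  [TopologicalSpace M] [ChartedSpace E M] [TopologicalSpace G] [ChartedSpace EG G]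
  [TopologicalSpace P] [ChartedSpace EP P]

/-- The bundle projection `[(r, v)] ↦ π(r)`. -/
def PrincipalBundle.base (B : PrincipalBundle E EG EP M G P) (x : AssocBundle P κ) : M :=
  Quotient.lift (s := assocSetoid P κ) (fun a => B.proj a.1) (by
    rintro a b ⟨g, h1, -⟩
    rw [h1, B.proj_act]) x

@[simp] theorem PrincipalBundle.base_mk (B : PrincipalBundle E EG EP M G P) (r : P) (v : X) :
    B.base (AssocBundle.mk κ r v) = B.proj r := rfl

theorem PrincipalBundle.mk_injective (B : PrincipalBundle E EG EP M G P) (r : P) :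
    Function.Injective (AssocBundle.mk κ r) := by
  intro v w h
  obtain ⟨g, h1, h2⟩ := Quotient.exact (s := assocSetoid P κ) h
  have : g⁻¹ = 1 := B.act_free (p := r) h1.symm
  rw [inv_eq_one] at this
  subst this
  rw [map_one] at h2
  exact h2.symm

theorem PrincipalBundle.exists_mk (B : PrincipalBundle E EG EP M G P) (r : P)
    (x : AssocBundle P κ) (h : B.base x = B.proj r) : ∃ v, AssocBundle.mk κ r v = x := by
  induction x using AssocBundle.ind with
  | h s w =>
    obtain ⟨g, hg⟩ := B.exists_act (p := r) (q := s) h.symm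
    refine ⟨κ g w, ?_⟩
    have := AssocBundle.mk_act (κ := κ) s g w
    rw [hg, smul_smul, ← MulOpposite.op_mul] at this
    simpa [hg] using this

theorem PrincipalBundle.coord_mk (B : PrincipalBundle E EG EP M G P) (r : P) (v : X) :
    AssocBundle.coord r (AssocBundle.mk κ r v) = v := by
  have h : ∃ w, AssocBundle.mk κ r w = AssocBundle.mk κ r v := ⟨v, rfl⟩
  rw [AssocBundle.coord, dif_pos h]
  exact B.mk_injective r h.choose_spec

theorem AssocBundle.mk_frameOf (x : AssocBundle P κ) :
    ∃ v, x = AssocBundle.mk κ x.frameOf v :=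
  ⟨(Quotient.out (s := assocSetoid P κ) x).2, (Quotient.out_eq (s := assocSetoid P κ) x).symm⟩

theorem PrincipalBundle.frameOf_mk (B : PrincipalBundle E EG EP M G P) (r : P) (v : X) :
    ∃ g : G, (AssocBundle.mk κ r v).frameOf = MulOpposite.op g⁻¹ • r := by
  obtain ⟨w, hw⟩ := AssocBundle.mk_frameOf (AssocBundle.mk κ r v)
  obtain ⟨g, h1, -⟩ := Quotient.exact (s := assocSetoid P κ) hw
  exact ⟨g, h1⟩

theorem PrincipalBundle.addSMul_mk (B : PrincipalBundle E EG EP M G P) (r : P) (v w : X) (t : ℝ) :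
    AssocBundle.addSMul (AssocBundle.mk κ r v) (AssocBundle.mk κ r w) t
      = AssocBundle.mk κ r (v + (t : ℂ) • w) := by
  obtain ⟨g, hg⟩ := B.frameOf_mk (κ := κ) r v
  rw [AssocBundle.addSMul, hg, ← AssocBundle.mk_act r g v, ← AssocBundle.mk_act r g w,
    B.coord_mk, B.coord_mk, ← AssocBundle.mk_act r g (v + (t : ℂ) • w)]
  rw [_root_.map_add, _root_.map_smul]

end Associated

/-! ### The bundle of measurements acting on the oscillator bundle; Kuiper maps -/

section Kuiper

variable {E EG EP M G P : Type*} [NormedAddCommGroup E] [NormedSpace ℝ E]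
  [NormedAddCommGroup EG] [NormedSpace ℝ EG] [NormedAddCommGroup EP] [NormedSpace ℝ EP]
  [TopologicalSpace M] [ChartedSpace E M]
  [Group G] [TopologicalSpace G] [ChartedSpace EG G]
  [TopologicalSpace P] [ChartedSpace EP P] [MulAction Gᵐᵒᵖ P]
  {K : Type*} [NormedAddCommGroup K] [InnerProductSpace ℂ K] [CompleteSpace K]

/-- The fibrewise action `[(q, f)] · [(q, a)] = [(q, f ∘ a)]` of the bundle of measurements. -/
def measAct {τ : G →* (K ≃ₗᵢ[ℂ] K)} (h : AssocBundle P (dualRep τ))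
    (c : AssocBundle P (conjRep τ)) : AssocBundle P (dualRep τ) :=
  AssocBundle.mk (dualRep τ) h.frameOf
    (dualAct (AssocBundle.coord h.frameOf h) (AssocBundle.coord h.frameOf c))

theorem PrincipalBundle.measAct_mk (B : PrincipalBundle E EG EP M G P) (τ : G →* (K ≃ₗᵢ[ℂ] K))
    (q : P) (f : HDual K) (a : CompOp K) :
    measAct (AssocBundle.mk (dualRep τ) q f) (AssocBundle.mk (conjRep τ) q a)
      = AssocBundle.mk (dualRep τ) q (dualAct f a) := by
  obtain ⟨g, hg⟩ := B.frameOf_mk (κ := dualRep τ) q f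
  rw [measAct, hg, ← AssocBundle.mk_act (κ := dualRep τ) q g f,
    ← AssocBundle.mk_act (κ := conjRep τ) q g a, B.coord_mk, B.coord_mk,
    ← AssocBundle.mk_act (κ := dualRep τ) q g (dualAct f a)]
  congr 1
  ext v
  simp [dualAct, dualRep, conjRep, dualEquiv, conjEquiv, conjFun]

/-- A (normalized) Kuiper map: a fibre preserving homeomorphism of the associated bundle
`P ×_σ H` onto `M × H` that is linear and unitary in each fibre. -/
structure KuiperMap (B : PrincipalBundle E EG EP M G P) (τ : G →* (K ≃ₗᵢ[ℂ] K)) where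
  toHomeo : AssocBundle P (dualRep τ) ≃ₜ M × HDual K
  fst_eq : ∀ x, (toHomeo x).1 = B.base x
  map_add : ∀ (r : P) (f g : HDual K), (toHomeo (AssocBundle.mk _ r (f + g))).2
    = (toHomeo (AssocBundle.mk _ r f)).2 + (toHomeo (AssocBundle.mk _ r g)).2
  map_smul : ∀ (r : P) (c : ℂ) (f : HDual K), (toHomeo (AssocBundle.mk _ r (c • f))).2
    = c • (toHomeo (AssocBundle.mk _ r f)).2
  unitary : ∀ (r : P) (f g : HDual K),
    dualInner (toHomeo (AssocBundle.mk _ r f)).2 (toHomeo (AssocBundle.mk _ r g)).2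
      = dualInner f g

namespace KuiperMap

variable {B : PrincipalBundle E EG EP M G P} {τ : G →* (K ≃ₗᵢ[ℂ] K)} (J : KuiperMap B τ)

/-- The unitary map `f ↦ pr₂ J [(r, f)]` of `H`. -/
def fib (r : P) : HDual K ≃ₗᵢ[ℂ] HDual K :=
  LinearIsometryEquiv.ofSurjective
    { toFun := fun f => (J.toHomeo (AssocBundle.mk _ r f)).2
      map_add' := J.map_add r
      map_smul' := J.map_smul r
      norm_map' := fun f => by
        have h := J.unitary r f f
        rw [dualInner_self, dualInner_self] at h
        have h' := Complex.ofReal_injective h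
        exact (sq_eq_sq₀ (norm_nonneg _) (norm_nonneg _)).1 h' }
    (by
      intro w
      have hb : B.base (J.toHomeo.symm (B.proj r, w)) = B.proj r := by
        rw [← J.fst_eq, Homeomorph.apply_symm_apply]
      obtain ⟨v, hv⟩ := B.exists_mk r _ hb
      refine ⟨v, ?_⟩
      change (J.toHomeo (AssocBundle.mk _ r v)).2 = w
      rw [hv, Homeomorph.apply_symm_apply])

theorem fib_apply (r : P) (f : HDual K) :
    J.fib r f = (J.toHomeo (AssocBundle.mk (dualRep τ) r f)).2 := rfl

/-- The unitary map `v ↦ (pr₂ J [(r, v♭)])♯` of the predual, i.e. the fibre map of the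
trivialization `J̌ = ♯ ∘ J ∘ ♭`. -/
def checkFib (r : P) : K ≃ₗᵢ[ℂ] K :=
  ((InnerProductSpace.toDual ℂ K).trans (J.fib r)).trans (InnerProductSpace.toDual ℂ K).symm

theorem checkFib_apply (r : P) (v : K) : J.checkFib r v = sharp (J.fib r (flat v)) := rfl

theorem checkFib_act (r : P) (g : G) (v : K) :
    J.checkFib (MulOpposite.op g⁻¹ • r) (τ g v) = J.checkFib r v := by
  have h : flat (τ g v) = dualRep τ g (flat v) := by
    ext w
    change inner ℂ (τ g v) w = inner ℂ v ((τ g).symm w)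
    rw [← (τ g).inner_map_map v, LinearIsometryEquiv.apply_symm_apply]
  rw [checkFib_apply, checkFib_apply, h, fib_apply, AssocBundle.mk_act, fib_apply]

theorem fib_eq_comp (r : P) (f : HDual K) (w : K) :
    J.fib r f (J.checkFib r w) = f w := by
  have h : ∀ (f : HDual K) (v : K), f v = inner ℂ (sharp f) v := by
    intro f v
    exact (InnerProductSpace.toDual_symm_apply (𝕜 := ℂ)).symm
  have h2 := J.unitary r (flat w) f
  rw [← fib_apply, ← fib_apply] at h2
  unfold dualInner at h2
  rw [← checkFib_apply, ← h] at h2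
  rw [h2, h f w]
  congr 1
  exact (InnerProductSpace.toDual ℂ K).symm_apply_apply w

/-- The trivialization `J_CH` of the bundle of measurements induced by `J`. It is the fibrewise
linear and continuous map with `J_CH [(r, v ⊗ f)] = (π(r), pr₂ J̌[(r, v)] ⊗ pr₂ J[(r, f)])`; see
`measTriv_rankOne`, `measTriv_add`, `measTriv_smul`, `measTriv_tendsto`. -/
def measTrivFun (c : AssocBundle P (conjRep τ)) : M × CompOp K :=
  Quotient.lift (s := assocSetoid P (conjRep τ))
    (fun x => (B.proj x.1, conjEquiv (J.checkFib x.1) x.2)) (by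
      rintro ⟨r, a⟩ ⟨s, b⟩ ⟨g, h1, h2⟩
      dsimp only at h1 h2 ⊢
      subst h1 h2
      refine Prod.ext (B.proj_act _ _).symm ?_
      ext v
      change J.checkFib r ((a : K →L[ℂ] K) ((J.checkFib r).symm v))
        = J.checkFib (MulOpposite.op g⁻¹ • r) (τ g ((a : K →L[ℂ] K)
          ((τ g).symm ((J.checkFib (MulOpposite.op g⁻¹ • r)).symm v))))
      rw [checkFib_act]
      congr 2
      rw [LinearIsometryEquiv.symm_apply_eq, ← J.checkFib_act r g]
      simp) c

theorem measTrivFun_mk (r : P) (a : CompOp K) :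
    J.measTrivFun (AssocBundle.mk (conjRep τ) r a) = (B.proj r, conjEquiv (J.checkFib r) a) := rfl

theorem measTrivFun_bijective : Function.Bijective J.measTrivFun := by
  constructor
  · intro c d h
    induction c using AssocBundle.ind with
    | h r a =>
      have hb : B.base d = B.proj r := by
        induction d using AssocBundle.ind with
        | h s b => exact (congrArg Prod.fst h).symm
      obtain ⟨b, rfl⟩ := B.exists_mk r d hb
      rw [measTrivFun_mk, measTrivFun_mk] at h
      rw [(conjEquiv (J.checkFib r)).injective (congrArg Prod.snd h)]
  · rintro ⟨m, a⟩
    obtain ⟨r, rfl⟩ := B.proj_surjective m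
    exact ⟨AssocBundle.mk _ r ((conjEquiv (J.checkFib r)).symm a), by simp [measTrivFun_mk]⟩

/-- `J_CH` as a bijection. -/
def measTriv : AssocBundle P (conjRep τ) ≃ M × CompOp K :=
  Equiv.ofBijective J.measTrivFun J.measTrivFun_bijective

theorem measTriv_rankOne (r : P) (v : K) (f : HDual K) :
    J.measTriv (AssocBundle.mk _ r (rankOneOp v f))
      = (B.proj r, rankOneOp (sharp (J.toHomeo (AssocBundle.mk _ r (flat v))).2)
          (J.toHomeo (AssocBundle.mk _ r f)).2) := by
  refine Prod.ext rfl ?_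
  ext w
  change J.checkFib r (f ((J.checkFib r).symm w) • v) = J.fib r f w • J.checkFib r v
  have := J.fib_eq_comp r f ((J.checkFib r).symm w)
  rw [LinearIsometryEquiv.apply_symm_apply] at this
  rw [_root_.map_smul, this]

theorem measTriv_add (r : P) (a b : CompOp K) :
    (J.measTriv (AssocBundle.mk _ r (a + b))).2
      = (J.measTriv (AssocBundle.mk _ r a)).2 + (J.measTriv (AssocBundle.mk _ r b)).2 :=
  _root_.map_add (conjEquiv (J.checkFib r)) a b

theorem measTriv_smul (r : P) (c : ℂ) (a : CompOp K) :
    (J.measTriv (AssocBundle.mk _ r (c • a))).2 = c • (J.measTriv (AssocBundle.mk _ r a)).2 :=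
  _root_.map_smul (conjEquiv (J.checkFib r)) c a

theorem measTriv_tendsto (r : P) (a : CompOp K) (b : ℕ → CompOp K)
    (h : Filter.Tendsto b Filter.atTop (𝓝 a)) :
    Filter.Tendsto (fun i => (J.measTriv (AssocBundle.mk _ r (b i))).2) Filter.atTop
      (𝓝 (J.measTriv (AssocBundle.mk _ r a)).2) :=
  ((conjEquiv (J.checkFib r)).continuous.tendsto a).comp h

/-- The total space of the oscillator bundle, to be equipped with the Kuiper structure. -/
def Total (_ : KuiperMap B τ) : Type _ := AssocBundle P (dualRep τ)

instance : TopologicalSpace J.Total := inferInstanceAs (TopologicalSpace (AssocBundle P (dualRep τ)))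

/-- The Kuiper map on the total space. -/
def triv : J.Total ≃ₜ M × HDual K := J.toHomeo

/-- The bundle projection. -/
def pt (x : J.Total) : M := B.base (κ := dualRep τ) x

/-- The smooth structure in which `J` is a chart: the charts are the compositions of `J` with the
charts of `M × H`. -/
instance : ChartedSpace (ModelProd E (HDual K)) J.Total :=
  letI : ChartedSpace (M × HDual K) J.Total :=
    J.triv.toOpenPartialHomeomorph.singletonChartedSpace rfl
  ChartedSpace.comp (ModelProd E (HDual K)) (M × HDual K) J.Total

/-- The right action `h · a = h · J_CH⁻¹(m, a)` of compact operators on the fibre over `m`. -/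
def act (h : J.Total) (a : CompOp K) : J.Total :=
  measAct (τ := τ) h (J.measTriv.symm (J.pt h, a))

/-- Smooth sections of the oscillator bundle. -/
def IsSmoothSection (s : M → J.Total) : Prop :=
  (∀ m, J.pt (s m) = m) ∧
    ContMDiff 𝓘(ℝ, E) (𝓘(ℝ, E).prod 𝓘(ℝ, HDual K)) ∞ s

/-- The pointwise action of compact operators on sections. -/
def secAct (s : M → J.Total) (a : CompOp K) : M → J.Total := fun m => J.act (s m) a

/-- The model with corners of `M × H` and of the oscillator bundle. -/
abbrev model (_ : KuiperMap B τ) : ModelWithCorners ℝ (E × HDual K) (ModelProd E (HDual K)) :=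
  𝓘(ℝ, E).prod 𝓘(ℝ, HDual K)

/-- The product connection `Φ^H (t, v) = (0, v)` on `M × H → M`. -/
def prodConnection (ξ : TangentBundle J.model (M × HDual K)) :
    TangentBundle J.model (M × HDual K) :=
  ⟨ξ.1, ((0, (show E × HDual K from ξ.2).2) : E × HDual K)⟩

/-- The Kuiper connection `Φ = TJ⁻¹ ∘ Φ^H ∘ TJ`. -/
def connection (ξ : TangentBundle J.model J.Total) : TangentBundle J.model J.Total :=
  tangentMap J.model J.model J.triv.symm
    (J.prodConnection (tangentMap J.model J.model J.triv ξ))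

/-- The curve `t ↦ x + t y` in a fibre. -/
def line (x y : J.Total) (t : ℝ) : J.Total := AssocBundle.addSMul (κ := dualRep τ) x y t

/-- The fibre product of the oscillator bundle with itself. -/
def FibreProd : Type _ :=
  {x : J.Total × J.Total // J.pt x.1 = J.pt x.2}

/-- The vertical lift `vl(x, y) = d/dt (x + t y)` at `t = 0`, a tangent vector at `x`. -/
def verticalLift (z : J.FibreProd) : TangentBundle J.model J.Total :=
  tangentMap 𝓘(ℝ, ℝ) J.model (J.line z.1.1 z.1.2) ⟨0, (1 : ℝ)⟩

/-- The connector `pr₂ ∘ vl⁻¹ ∘ Φ` of the Kuiper connection. -/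
def connector (ξ : TangentBundle J.model J.Total) : J.Total :=
  haveI : Nonempty J.FibreProd := ⟨⟨(ξ.1, ξ.1), rfl⟩⟩
  (Function.invFun J.verticalLift (J.connection ξ)).1.2

/-- The covariant derivative `∇_X s = connector ∘ Ts ∘ X` of the Kuiper connection. -/
def covDeriv (X : ∀ m : M, TangentSpace 𝓘(ℝ, E) m) (s : M → J.Total) : M → J.Total :=
  fun m => J.connector (tangentMap 𝓘(ℝ, E) J.model s ⟨m, X m⟩)

/-- The local representative of a section in a chart `e` of `M` and the bundle chart `J`. -/
def localRep (s : M → J.Total) (e : OpenPartialHomeomorph M E) (x : E) : HDual K :=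
  (J.triv (s (e.symm x))).2

/-- `D` is a linear differential operator of order at most `k` on the smooth sections: it maps
smooth sections to smooth sections, and in each chart of the smooth manifold `M` it has the form
`∑ a_I(x) ∂_I` with smooth coefficients in the bounded operators of the fibre, the sum being
over the multi-indices `I = (i_1, …, i_j)` with `j ≤ k`. -/
def IsDifferentialOperator [FiniteDimensional ℝ E] (k : ℕ) (D : (M → J.Total) → (M → J.Total)) : Prop :=
  (∀ s, J.IsSmoothSection s → J.IsSmoothSection (D s)) ∧
  ∀ e ∈ IsManifold.maximalAtlas 𝓘(ℝ, E) ∞ M,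
    ∃ a : (j : ℕ) → (Fin j → Fin (Module.finrank ℝ E)) → E → (HDual K →L[ℂ] HDual K),
      (∀ j ≤ k, ∀ I, ContDiffOn ℝ ∞ (a j I) e.target) ∧
      ∀ s, J.IsSmoothSection s → ∀ x ∈ e.target,
        J.localRep (D s) e x = ∑ j ∈ Finset.range (k + 1), ∑ I : Fin j → Fin (Module.finrank ℝ E),
          a j I x (iteratedFDeriv ℝ j (J.localRep s e) x
            (fun l => Module.finBasis ℝ E (I l)))

end KuiperMap

end Kuiper

/-! ### Symplectic manifolds and metaplectic structures -/

section SymplecticManifold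

variable (E M : Type*) [NormedAddCommGroup E] [NormedSpace ℝ E]
  [TopologicalSpace M] [ChartedSpace E M]

/-- The representative of a 2-form in the inverse of the preferred chart at `x`. -/
def formInChart (Ω : ∀ m : M, TangentSpace 𝓘(ℝ, E) m [⋀^Fin 2]→L[ℝ] ℝ) (x : M) (y : E) :
    E [⋀^Fin 2]→L[ℝ] ℝ :=
  (Ω ((chartAt E x).symm y)).compContinuousLinearMap
    (mfderiv 𝓘(ℝ, E) 𝓘(ℝ, E) (chartAt E x).symm y)

/-- A symplectic form on `M`: a smooth, closed and nondegenerate 2-form. -/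
structure SymplecticForm where
  form : ∀ m : M, TangentSpace 𝓘(ℝ, E) m [⋀^Fin 2]→L[ℝ] ℝ
  smooth : ∀ x : M, ContDiffOn ℝ ∞ (formInChart E M form x) (chartAt E x).target
  closed : ∀ x : M, ∀ y ∈ (chartAt E x).target, extDeriv (formInChart E M form x) y = 0
  nondegenerate : ∀ (m : M) (u : TangentSpace 𝓘(ℝ, E) m),
    (∀ v : TangentSpace 𝓘(ℝ, E) m, form m ![u, v] = 0) → u = 0

variable {E M} {V : Type*} [NormedAddCommGroup V] [InnerProductSpace ℝ V]

/-- A symplectic frame of `M`: a linear map `A : V → T_m M` with `Ω_m(A u, A v) = ω₀(u, v)`. -/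
structure SymplecticFrame (S : SymplecticSpace V) (Ω : SymplecticForm E M) where
  pt : M
  map : V →L[ℝ] TangentSpace 𝓘(ℝ, E) pt
  symplectic : ∀ u v : V, Ω.form pt ![map u, map v] = S.form u v

/-- The right action `A ↦ A ∘ g` of the symplectic group on symplectic frames. -/
def SymplecticFrame.act {S : SymplecticSpace V} {Ω : SymplecticForm E M}
    (A : SymplecticFrame S Ω) (g : S.Sp) : SymplecticFrame S Ω where
  pt := A.pt
  map := A.map ∘L S.toEnd g
  symplectic u v := (A.symplectic _ _).trans (g.2 u v)

/-- A metaplectic structure: a principal bundle `P` of the metaplectic group with a smooth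
equivariant map `Λ` over `M` to the bundle of symplectic frames. (That bundle is an embedded
subbundle of `Hom(V, TM)`, so that `Λ` is smooth iff all the maps `p ↦ Λ(p) v ∈ TM` are.) -/
structure MetaplecticStructure [IsManifold 𝓘(ℝ, E) ∞ M] [FiniteDimensional ℝ V] [MeasurableSpace V] [BorelSpace V]
    {S : SymplecticSpace V} {EG : Type*} [NormedAddCommGroup EG] [NormedSpace ℝ EG]
    {G : Type*} [Group G] [TopologicalSpace G] [ChartedSpace EG G] (mp : MetaplecticGroup S EG G)
    (Ω : SymplecticForm E M) (EP : Type*) [NormedAddCommGroup EP] [NormedSpace ℝ EP]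
    (P : Type*) [TopologicalSpace P] [ChartedSpace EP P] [MulAction Gᵐᵒᵖ P]
    extends PrincipalBundle E EG EP M G P where
  frame : P → SymplecticFrame S Ω
  frame_pt : ∀ p, (frame p).pt = proj p
  frame_act : ∀ (p : P) (g : G), frame (MulOpposite.op g • p) = (frame p).act (mp.cov g)
  smooth_frame : ∀ v : V, ContMDiff 𝓘(ℝ, EP) 𝓘(ℝ, E).tangent ∞
    (fun p => (⟨(frame p).pt, (frame p).map v⟩ : TangentBundle 𝓘(ℝ, E) M))

end SymplecticManifold

end Oscillator

end

namespace Oscillator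

/-! Everything becomes transparent once read through `J`. A section is then a function `s̄ : M → H`,
its principal part. Since `J` is used as a chart, `s` is smooth exactly when `s̄` is, and in the
charts induced by `J` the tangent map `TJ` is the identity of `E × H`. Hence the Kuiper connection
is `(t, v) ↦ (0, v)`, the connector returns the `H`-component of a tangent vector (`connector_mk`),
and `∇_X s` has principal part `ds̄(X)` (`covDeriv_apply`). In a chart of `M` this is `∑ Xⁱ ∂ᵢ` with
scalar coefficients and no term of order zero (`localRep_covDeriv`).

For the Leibniz-type rule, the trivialization in a frame `r` acts on functionals as `f ↦ f ∘ U⁻¹`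
with `U = J.checkFib r` unitary, while `J_CH` conjugates by the same `U`. The two dependences on the
frame cancel, so acting by `a` becomes `s̄ ↦ s̄ ∘ a` with `a` fixed (`triv_act`). This is one
constant bounded linear map of `H`, and a constant linear map commutes with the differential. -/

theorem contDiffOn_smul_vector {E F : Type*} [NormedAddCommGroup E] [NormedSpace ℝ E]
    [NormedAddCommGroup F] [NormedSpace ℝ F] {n : WithTop ℕ∞} {c : E → ℝ} {s : Set E}
    (hc : ContDiffOn ℝ n c s) (v : F) : ContDiffOn ℝ n (fun x => c x • v) s :=
  hc.smul contDiffOn_const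

namespace KuiperMap

variable {E EG EP M G P : Type*} [NormedAddCommGroup E] [NormedSpace ℝ E]
  [NormedAddCommGroup EG] [NormedSpace ℝ EG] [NormedAddCommGroup EP] [NormedSpace ℝ EP]
  [TopologicalSpace M] [ChartedSpace E M]
  [Group G] [TopologicalSpace G] [ChartedSpace EG G]
  [TopologicalSpace P] [ChartedSpace EP P] [MulAction Gᵐᵒᵖ P]
  {K : Type*} [NormedAddCommGroup K] [InnerProductSpace ℂ K] [CompleteSpace K]
  {B : PrincipalBundle E EG EP M G P} {τ : G →* (K ≃ₗᵢ[ℂ] K)} (J : KuiperMap B τ)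

/-! ### The fibre operations in the trivialization `J` -/

theorem triv_fst (x : J.Total) : (J.triv x).1 = J.pt x := J.fst_eq x

theorem pt_triv_symm (y : M × HDual K) : J.pt (J.triv.symm y) = y.1 := by
  rw [← triv_fst, Homeomorph.apply_symm_apply]

theorem triv_eq (x : J.Total) : J.triv x = (J.pt x, (J.triv x).2) :=
  Prod.ext (J.triv_fst x) rfl

/-- With `U = J.checkFib r`, the operator `J_CH⁻¹(m, a)` has coordinate `U⁻¹ a U` in the frame `r`,
and `(f ∘ U⁻¹ a U) ∘ U⁻¹ = (f ∘ U⁻¹) ∘ a`. -/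
theorem triv_act (h : J.Total) (a : CompOp K) :
    J.triv (J.act h a) = (J.pt h, dualAct (J.triv h).2 a) := by
  induction h using AssocBundle.ind with
  | h r f =>
    set U := J.checkFib r with hU
    have hc : J.measTriv.symm (B.proj r, a)
        = AssocBundle.mk (conjRep τ) r ((conjEquiv U).symm a) := by
      rw [Equiv.symm_apply_eq]
      exact Prod.ext rfl ((conjEquiv U).apply_symm_apply a).symm
    have hact : J.act (AssocBundle.mk (dualRep τ) r f) a
        = AssocBundle.mk (dualRep τ) r (dualAct f ((conjEquiv U).symm a)) := by
      change measAct (AssocBundle.mk (dualRep τ) r f) (J.measTriv.symm (B.proj r, a)) = _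
      rw [hc, B.measAct_mk]
    rw [hact]
    refine Prod.ext (J.fst_eq _) ?_
    change J.fib r (dualAct f ((conjEquiv U).symm a)) = dualAct (J.fib r f) a
    ext w
    -- `fib_eq_comp` evaluates image functionals on vectors `U u`; by surjectivity of `U` these are
    -- all vectors.
    obtain ⟨u, rfl⟩ := U.surjective w
    rw [hU, J.fib_eq_comp]
    change f (U.symm ((a : K →L[ℂ] K) (U u))) = J.fib r f ((a : K →L[ℂ] K) (U u))
    rw [← J.fib_eq_comp r f, ← hU, LinearIsometryEquiv.apply_symm_apply]

/-- `J` is complex linear on fibres, so fibre lines become affine lines; the scalar `t` enters as a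
complex number and is read back as a real one. -/
theorem triv_line (x y : J.Total) (h : J.pt x = J.pt y) (t : ℝ) :
    J.triv (J.line x y t) = (J.pt x, (J.triv x).2 + t • (J.triv y).2) := by
  induction x using AssocBundle.ind with
  | h r f =>
    obtain ⟨g, rfl⟩ := B.exists_mk r y h.symm
    have hl : J.line (AssocBundle.mk (dualRep τ) r f) (AssocBundle.mk (dualRep τ) r g) t
        = AssocBundle.mk (dualRep τ) r (f + (t : ℂ) • g) := B.addSMul_mk r f g t
    rw [hl]
    refine Prod.ext (J.fst_eq _) ?_
    change J.fib r (f + (t : ℂ) • g) = J.fib r f + t • J.fib r g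
    rw [_root_.map_add, _root_.map_smul]
    rfl

/-! ### Smoothness and derivatives through `J` -/

section Smooth

variable {EN HN N : Type*} [NormedAddCommGroup EN] [NormedSpace ℝ EN] [TopologicalSpace HN]
  {I : ModelWithCorners ℝ EN HN} [TopologicalSpace N] [ChartedSpace HN N]

/-- The charts of the total space are `J` followed by charts of `M × H`, so `f` and `J ∘ f` have
literally the same coordinate expression. Only the continuity conditions differ, and they agree
because `J` is a homeomorphism. -/
theorem contMDiff_iff_triv_comp {n : WithTop ℕ∞} {f : N → J.Total} :
    ContMDiff I J.model n f ↔ ContMDiff I J.model n (fun x => J.triv (f x)) := by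
  refine forall_congr' fun x => ?_
  rw [contMDiffAt_iff, contMDiffAt_iff]
  exact and_congr (J.triv.comp_continuousAt_iff f x).symm Iff.rfl

theorem hasMFDerivAt_iff_triv_comp {f : N → J.Total} {x : N} {f' : EN →L[ℝ] E × HDual K} :
    HasMFDerivAt I J.model f x f' ↔ HasMFDerivAt I J.model (fun z => J.triv (f z)) x f' :=
  and_congr (J.triv.comp_continuousAt_iff f x).symm Iff.rfl

theorem hasMFDerivAt_triv (x : J.Total) :
    HasMFDerivAt J.model J.model J.triv x (ContinuousLinearMap.id ℝ (E × HDual K)) :=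
  J.hasMFDerivAt_iff_triv_comp.1 (hasMFDerivAt_id x)

theorem hasMFDerivAt_triv_symm (y : M × HDual K) :
    HasMFDerivAt J.model J.model J.triv.symm y (ContinuousLinearMap.id ℝ (E × HDual K)) := by
  rw [hasMFDerivAt_iff_triv_comp, funext J.triv.apply_symm_apply]
  exact hasMFDerivAt_id y

end Smooth

/-! ### The connection, the vertical lift and the connector -/

theorem connection_mk (x : J.Total) (w : E × HDual K) :
    J.connection ⟨x, w⟩ = ⟨x, ((0, w.2) : E × HDual K)⟩ := by
  have h1 : tangentMap J.model J.model J.triv ⟨x, w⟩ = ⟨J.triv x, w⟩ := by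
    rw [tangentMap, (J.hasMFDerivAt_triv x).mfderiv]; rfl
  have h2 : ∀ (y : M × HDual K) (u : E × HDual K),
      tangentMap J.model J.model J.triv.symm ⟨y, u⟩ = ⟨J.triv.symm y, u⟩ := by
    intro y u
    rw [tangentMap, (J.hasMFDerivAt_triv_symm y).mfderiv]; rfl
  -- The base points `J⁻¹(J x)` and `x` are only propositionally equal. All tangent spaces are the
  -- same model space `E × H`, so the vector needs no transport.
  have h3 : ∀ (x' : J.Total) (u : E × HDual K), x' = x →
      (⟨x', u⟩ : TangentBundle J.model J.Total) = ⟨x, u⟩ := by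
    rintro _ u rfl
    rfl
  rw [connection, h1, prodConnection, h2]
  exact h3 _ _ (J.triv.symm_apply_apply x)

/-- In the trivialization the curve is `t ↦ (pt x, x̄ + t ȳ)`: constant in the base and affine in
the fibre, with velocity `(0, ȳ)`. -/
theorem verticalLift_mk (x y : J.Total) (h : J.pt x = J.pt y) :
    J.verticalLift ⟨(x, y), h⟩ = ⟨x, ((0, (J.triv y).2) : E × HDual K)⟩ := by
  have hl := J.triv_line x y h
  have h0 : J.line x y 0 = x := by
    apply J.triv.injective
    have h1 : (J.triv x).2 + (0 : ℝ) • (J.triv y).2 = (J.triv x).2 :=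
      (congrArg _ (zero_smul ℝ (J.triv y).2)).trans (add_zero _)
    rw [hl, h1, ← triv_eq]
  have hd : HasMFDerivAt 𝓘(ℝ, ℝ) J.model (J.line x y) 0
      ((0 : ℝ →L[ℝ] E).prod (ContinuousLinearMap.toSpanSingleton ℝ (J.triv y).2)) := by
    rw [hasMFDerivAt_iff_triv_comp, funext hl]
    exact (hasMFDerivAt_const _ _).prodMk
      (((ContinuousLinearMap.toSpanSingleton ℝ (J.triv y).2).hasFDerivAt.const_add
        (J.triv x).2).hasMFDerivAt)
  change (⟨J.line x y 0, mfderiv 𝓘(ℝ, ℝ) J.model (J.line x y) 0 (1 : ℝ)⟩ :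
    TangentBundle J.model J.Total) = _
  rw [hd.mfderiv]
  have h3 : ∀ (x' : J.Total) (u v : E × HDual K), x' = x → u = v →
      (⟨x', u⟩ : TangentBundle J.model J.Total) = ⟨x, v⟩ := by
    rintro _ u _ rfl rfl
    rfl
  exact h3 _ _ _ h0 (Prod.ext rfl (one_smul ℝ _))

/-- The value of the connection at a tangent vector is vertical, hence is a vertical lift, and any
preimage has its second component determined by `w.2` and the base point. The choice made by
`Function.invFun` is therefore harmless. -/
theorem connector_mk (x : J.Total) (w : E × HDual K) :
    J.connector ⟨x, w⟩ = J.triv.symm (J.pt x, w.2) := by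
  have : Nonempty J.FibreProd := ⟨⟨(x, x), rfl⟩⟩
  have hpt : J.pt x = J.pt (J.triv.symm (J.pt x, w.2)) :=
    (J.pt_triv_symm (J.pt x, w.2)).symm
  have hz : J.verticalLift ⟨(x, J.triv.symm (J.pt x, w.2)), hpt⟩
      = J.connection ⟨x, w⟩ := by
    rw [verticalLift_mk, connection_mk, Homeomorph.apply_symm_apply]
  have hinj : ∀ z : J.FibreProd, J.verticalLift z = J.connection ⟨x, w⟩ →
      z.1.2 = J.triv.symm (J.pt x, w.2) := by
    rintro ⟨⟨x', y⟩, h⟩ hy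
    rw [verticalLift_mk, connection_mk] at hy
    obtain ⟨h1, h2⟩ := Bundle.TotalSpace.mk.inj hy
    have h3 : ((0, (J.triv y).2) : E × HDual K) = (0, w.2) := eq_of_heq h2
    rw [Homeomorph.eq_symm_apply]
    refine Prod.ext ?_ (by simpa only using congrArg Prod.snd h3)
    rw [triv_fst, ← h1]
    exact h.symm
  exact hinj _ (Function.invFun_eq ⟨_, hz⟩)

/-! ### Sections and their covariant derivative -/

/-- The principal part of a section in the trivialization `J`. -/
noncomputable def principalPart (s : M → J.Total) (m : M) : HDual K := (J.triv (s m)).2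

theorem triv_section {s : M → J.Total} (hs : ∀ m, J.pt (s m) = m) (m : M) :
    J.triv (s m) = (m, J.principalPart s m) := by
  rw [triv_eq, hs]; rfl

theorem isSmoothSection_iff {s : M → J.Total} :
    J.IsSmoothSection s ↔ (∀ m, J.pt (s m) = m) ∧
      ContMDiff 𝓘(ℝ, E) 𝓘(ℝ, HDual K) ∞ (J.principalPart s) := by
  refine and_congr_right fun hs => ?_
  rw [contMDiff_iff_triv_comp]
  refine ⟨fun h => contMDiff_snd.comp h, fun h => ?_⟩
  rw [funext (J.triv_section hs)]
  exact contMDiff_id.prodMk h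

/-- Through `J` the section is the graph `m ↦ (m, s̄ m)`, whose differential is `(id, ds̄)`; the
connector keeps the second component. -/
theorem covDeriv_apply (X : ∀ m : M, TangentSpace 𝓘(ℝ, E) m) {s : M → J.Total}
    (hs : J.IsSmoothSection s) (m : M) :
    J.covDeriv X s m = J.triv.symm
      (m, mfderiv 𝓘(ℝ, E) 𝓘(ℝ, HDual K) (J.principalPart s) m (X m)) := by
  have hp := (J.isSmoothSection_iff.1 hs).2
  have hd : HasMFDerivAt 𝓘(ℝ, E) J.model s m ((ContinuousLinearMap.id ℝ E).prod
      (show E →L[ℝ] HDual K from mfderiv 𝓘(ℝ, E) 𝓘(ℝ, HDual K) (J.principalPart s) m)) := by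
    rw [hasMFDerivAt_iff_triv_comp, funext (J.triv_section hs.1)]
    exact (hasMFDerivAt_id m).prodMk
      ((hp.mdifferentiable (by simp)) m).hasMFDerivAt
  rw [covDeriv, tangentMap, hd.mfderiv]
  refine (J.connector_mk _ _).trans ?_
  rw [hs.1]
  rfl

theorem principalPart_covDeriv (X : ∀ m : M, TangentSpace 𝓘(ℝ, E) m) {s : M → J.Total}
    (hs : J.IsSmoothSection s) (m : M) :
    J.principalPart (J.covDeriv X s) m
      = mfderiv 𝓘(ℝ, E) 𝓘(ℝ, HDual K) (J.principalPart s) m (X m) := by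
  rw [principalPart, covDeriv_apply J X hs, Homeomorph.apply_symm_apply]

/-! ### Compatibility with the action of compact operators -/

/-- Precomposition with a compact operator, as a continuous real linear map of functionals. -/
noncomputable def dualActL (a : CompOp K) : HDual K →L[ℝ] HDual K :=
  (ContinuousLinearMap.precomp ℂ (a : K →L[ℂ] K)).restrictScalars ℝ

theorem principalPart_secAct (s : M → J.Total) (a : CompOp K) :
    J.principalPart (J.secAct s a) = dualActL a ∘ J.principalPart s := by
  funext m
  exact congrArg Prod.snd (J.triv_act (s m) a)

theorem isSmoothSection_secAct {s : M → J.Total} (hs : J.IsSmoothSection s) (a : CompOp K) :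
    J.IsSmoothSection (J.secAct s a) := by
  rw [isSmoothSection_iff] at hs ⊢
  refine ⟨fun m => ?_, ?_⟩
  · rw [← triv_fst, secAct, triv_act, hs.1]
  · rw [principalPart_secAct]
    exact (dualActL a).contMDiff.comp hs.2

/-- Chain rule for `dualActL a ∘ s̄`: the outer map is linear and independent of the point, so it is
its own derivative and no extra term arises. -/
theorem covDeriv_secAct (X : ∀ m : M, TangentSpace 𝓘(ℝ, E) m) {s : M → J.Total}
    (hs : J.IsSmoothSection s) (a : CompOp K) :
    J.covDeriv X (J.secAct s a) = J.secAct (J.covDeriv X s) a := by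
  funext m
  have hp := (J.isSmoothSection_iff.1 hs).2.mdifferentiable (by simp) m
  apply J.triv.injective
  rw [covDeriv_apply J X (J.isSmoothSection_secAct hs a), Homeomorph.apply_symm_apply, secAct,
    triv_act, covDeriv_apply J X hs, pt_triv_symm, Homeomorph.apply_symm_apply,
    principalPart_secAct]
  have h := (((dualActL a).hasMFDerivAt).comp m hp.hasMFDerivAt).mfderiv
  rw [h]
  rfl

/-! ### The local form of the covariant derivative -/

section DifferentialOperator

variable {X : ∀ m : M, TangentSpace 𝓘(ℝ, E) m}

/-- The representative of a vector field in a chart. -/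
noncomputable def fieldInChart (X : ∀ m : M, TangentSpace 𝓘(ℝ, E) m)
    (e : OpenPartialHomeomorph M E) (x : E) : E :=
  mfderiv 𝓘(ℝ, E) 𝓘(ℝ, E) e (e.symm x) (X (e.symm x))

/-- The field in the chart is the fibre part of `Te ∘ X ∘ e⁻¹`, a composition of smooth maps. The
tangent map is taken within the open set `e.source`, where it agrees with the full one. -/
theorem contDiffOn_fieldInChart [IsManifold 𝓘(ℝ, E) ∞ M]
    (hX : ContMDiff 𝓘(ℝ, E) 𝓘(ℝ, E).tangent ∞
      (fun m => (⟨m, X m⟩ : TangentBundle 𝓘(ℝ, E) M)))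
    {e : OpenPartialHomeomorph M E} (he : e ∈ IsManifold.maximalAtlas 𝓘(ℝ, E) ∞ M) :
    ContDiffOn ℝ ∞ (fieldInChart X e) e.target := by
  refine contMDiffOn_vectorSpace_iff_contDiffOn.1 ?_
  have h1 : ContMDiffOn 𝓘(ℝ, E) 𝓘(ℝ, E) ∞ e e.source := contMDiffOn_of_mem_maximalAtlas he
  have h2 := h1.contMDiffOn_tangentMapWithin (m := ∞) (by simp) e.open_source.uniqueMDiffOn
  have h3 : ContMDiffOn 𝓘(ℝ, E) 𝓘(ℝ, E) ∞ e.symm e.target :=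
    contMDiffOn_symm_of_mem_maximalAtlas he
  refine (h2.comp (hX.comp_contMDiffOn h3) fun x hx => e.map_target hx).congr fun x hx => ?_
  have hs : e.symm x ∈ e.source := e.map_target hx
  change _ = (⟨e (e.symm x),
    mfderivWithin 𝓘(ℝ, E) 𝓘(ℝ, E) e e.source (e.symm x) (X (e.symm x))⟩ : TangentBundle 𝓘(ℝ, E) E)
  rw [mfderivWithin_of_isOpen e.open_source hs, e.right_inv hx]
  rfl

/-- Near `e.symm x` the principal part is the local representative composed with `e`; the chain rule
turns `ds̄(X)` into the derivative along the field in the chart. -/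
theorem localRep_covDeriv {s : M → J.Total} (hs : J.IsSmoothSection s)
    {e : OpenPartialHomeomorph M E} (he : e ∈ IsManifold.maximalAtlas 𝓘(ℝ, E) ∞ M)
    {x : E} (hx : x ∈ e.target) :
    J.localRep (J.covDeriv X s) e x = fderiv ℝ (J.localRep s e) x (fieldInChart X e x) := by
  have hp := (J.isSmoothSection_iff.1 hs).2.mdifferentiable (by simp)
  have hm : e.symm x ∈ e.source := e.map_target hx
  have hF : ContMDiffOn 𝓘(ℝ, E) 𝓘(ℝ, HDual K) ∞ (J.localRep s e) e.target :=
    (J.isSmoothSection_iff.1 hs).2.comp_contMDiffOn (contMDiffOn_symm_of_mem_maximalAtlas he)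
  have hF' : MDifferentiableAt 𝓘(ℝ, E) 𝓘(ℝ, HDual K) (J.localRep s e) (e (e.symm x)) := by
    rw [e.right_inv hx]
    exact (hF.contMDiffAt (e.open_target.mem_nhds hx)).mdifferentiableAt (by simp)
  have he' : MDifferentiableAt 𝓘(ℝ, E) 𝓘(ℝ, E) e (e.symm x) :=
    ((contMDiffOn_of_mem_maximalAtlas he).contMDiffAt
      (e.open_source.mem_nhds hm)).mdifferentiableAt (by simp)
  have heq : J.principalPart s =ᶠ[𝓝 (e.symm x)] J.localRep s e ∘ e := by
    filter_upwards [e.open_source.mem_nhds hm] with m hm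
    simp only [Function.comp, localRep, principalPart, e.left_inv hm]
  have hc := mfderiv_comp (e.symm x) hF' he'
  rw [← heq.mfderiv_eq, e.right_inv hx, mfderiv_eq_fderiv] at hc
  change J.principalPart (J.covDeriv X s) (e.symm x) = _
  rw [principalPart_covDeriv J X hs, hc]
  rfl

/-- The principal part of `∇_X s` is the vector component of the smooth map `Ts̄ ∘ X` into `TH = H ×
H`. -/
theorem isSmoothSection_covDeriv [IsManifold 𝓘(ℝ, E) ∞ M]
    (hX : ContMDiff 𝓘(ℝ, E) 𝓘(ℝ, E).tangent ∞
      (fun m => (⟨m, X m⟩ : TangentBundle 𝓘(ℝ, E) M)))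
    {s : M → J.Total} (hs : J.IsSmoothSection s) : J.IsSmoothSection (J.covDeriv X s) := by
  rw [isSmoothSection_iff]
  refine ⟨fun m => by rw [covDeriv_apply J X hs, pt_triv_symm], ?_⟩
  have h := ((J.isSmoothSection_iff.1 hs).2.contMDiff_tangentMap (m := ∞) (by simp)).comp hX
  have h2 : ContMDiff 𝓘(ℝ, HDual K).tangent 𝓘(ℝ, HDual K) ∞
      (fun ξ : TangentBundle 𝓘(ℝ, HDual K) (HDual K) => (ξ.2 : HDual K)) :=
    contMDiff_snd_tangentBundle_modelSpace _ _
  exact (h2.comp h).congr fun m => J.principalPart_covDeriv X hs m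

theorem isDifferentialOperator_covDeriv [IsManifold 𝓘(ℝ, E) ∞ M] [FiniteDimensional ℝ E]
    (hX : ContMDiff 𝓘(ℝ, E) 𝓘(ℝ, E).tangent ∞
      (fun m => (⟨m, X m⟩ : TangentBundle 𝓘(ℝ, E) M))) :
    J.IsDifferentialOperator 1 (J.covDeriv X) := by
  refine ⟨fun s hs => J.isSmoothSection_covDeriv hX hs, fun e he => ?_⟩
  let b := Module.finBasis ℝ E
  let c : Fin (Module.finrank ℝ E) → E → ℝ := fun i x => b.repr (fieldInChart X e x) i
  have hc : ∀ i, ContDiffOn ℝ ∞ (c i) e.target := fun i =>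
    ((b.coord i).toContinuousLinearMap.contDiff).comp_contDiffOn (contDiffOn_fieldInChart hX he)
  have hA : ∀ c : E → ℝ, ContDiffOn ℝ ∞ c e.target →
      ContDiffOn ℝ ∞ (fun x => c x • ContinuousLinearMap.id ℂ (HDual K)) e.target := fun c hc =>
    contDiffOn_smul_vector (F := HDual K →L[ℂ] HDual K) hc (ContinuousLinearMap.id ℂ (HDual K))
  -- One formula serves every order: the sum over `Fin j` is empty for `j = 0`, so there is no
  -- zeroth order term, and for `j = 1` it is the component `c (I 0) x` times the identity. Orders
  -- `j ≥ 2` do not enter.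
  refine ⟨fun j I x => ∑ l : Fin j, c (I l) x • ContinuousLinearMap.id ℂ (HDual K),
    fun j _ I => ContDiffOn.sum fun l _ => hA _ (hc (I l)),
    fun s hs x hx => ?_⟩
  rw [J.localRep_covDeriv hs he hx]
  conv_lhs => rw [← b.sum_repr (fieldInChart X e x)]
  rw [_root_.map_sum, Finset.sum_range_succ, Finset.sum_range_one]
  simp only [Finset.univ_eq_empty, Finset.sum_empty, zero_apply,
    Finset.sum_const_zero, zero_add, Fin.sum_univ_one, iteratedFDeriv_one_apply]
  -- Multi-indices of length one are identified with single indices, matching the expansion of the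
  -- field in the basis.
  rw [← (Equiv.funUnique (Fin 1) (Fin (Module.finrank ℝ E))).symm.sum_comp]
  refine Finset.sum_congr rfl fun i _ => ?_
  rw [_root_.map_smul]
  rfl

end DifferentialOperator

end KuiperMap
end Oscillator

theorem corollary15
    {V : Type*} [NormedAddCommGroup V] [InnerProductSpace ℝ V] [FiniteDimensional ℝ V]
    [Nontrivial V] [MeasurableSpace V] [BorelSpace V] (S : Oscillator.SymplecticSpace V)
    {EG : Type*} [NormedAddCommGroup EG] [NormedSpace ℝ EG] [FiniteDimensional ℝ EG]
    {G : Type*} [Group G] [TopologicalSpace G] [ChartedSpace EG G]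
    (mp : Oscillator.MetaplecticGroup S EG G)
    {ħ : ℝ} (hħ : ħ ≠ 0) (ssw : Oscillator.SegalShaleWeil mp ħ)
    {E : Type*} [NormedAddCommGroup E] [NormedSpace ℝ E] [FiniteDimensional ℝ E]
    (hdim : Module.finrank ℝ E = Module.finrank ℝ V)
    {M : Type*} [TopologicalSpace M] [T2Space M] [SecondCountableTopology M]
    [ChartedSpace E M] [IsManifold 𝓘(ℝ, E) ∞ M] (Ω : Oscillator.SymplecticForm E M)
    {EP : Type*} [NormedAddCommGroup EP] [NormedSpace ℝ EP] [FiniteDimensional ℝ EP]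
    {P : Type*} [TopologicalSpace P] [ChartedSpace EP P] [MulAction Gᵐᵒᵖ P]
    (B : Oscillator.MetaplecticStructure mp Ω EP P)
    (J : Oscillator.KuiperMap B.toPrincipalBundle ssw.rep)
    (X : ∀ m : M, TangentSpace 𝓘(ℝ, E) m)
    (hX : ContMDiff 𝓘(ℝ, E) 𝓘(ℝ, E).tangent ∞
      (fun m => (⟨m, X m⟩ : TangentBundle 𝓘(ℝ, E) M))) :
    J.IsDifferentialOperator 1 (J.covDeriv X) ∧
    ∀ s : M → J.Total, J.IsSmoothSection s → ∀ a : Oscillator.CompOp S.L2,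
      J.IsSmoothSection (J.secAct s a) ∧
      J.covDeriv X (J.secAct s a) = J.secAct (J.covDeriv X s) a :=
  ⟨J.isDifferentialOperator_covDeriv hX, fun _ hs a =>
    ⟨J.isSmoothSection_secAct hs a, J.covDeriv_secAct X hs a⟩⟩
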